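/- Let $\mathbb F_q$ be a finite field, let $1\le k\le n$ be integers and let $0\le\epsilon<1$. A source generates at each time $m=0,1,2,\dots$ a message $u_m\in\mathbb F_q^k$, and a $q$-ary memoryless erasure channel with erasure probability $\epsilon$ and without feedback is used once at each time $0,1,2,\dots$ (so $\lambda=\mu=1$); received symbols arrive without delay. For $l=0,1,2,\dots$, packet $l$ carries the message $u_{ln}$ generated at time $ln$ (all other messages are dropped): it is encoded as $z=u_{ln}^{T}G_l\in\mathbb F_q^n$ with a $k\times n$ generator matrix $G_l$ known to the receiver, and $z_1,\dots,z_n$ are sent at the times $ln,\dots,ln+n-1$. The columns of all the matrices $G_l$ are independent and uniformly distributed on $\mathbb F_q^k\setminus\{0\}$, and are independent of the erasures. The receiver decodes packet $l$ as soon as the symbols of this packet that were not erased contain $k$ linearly independent ones (that is, the corresponding columns of $G_l$ are linearly independent); if this does not happen within the $n$ channel uses, the packet is lost. The instantaneous age is $\Delta(t)=t-U(t)$, where $U(t)$ is the generation time of the freshest message decoded by time $t$; before the first decoding $U(t)=-a_0$ for a fixed initial age $a_0\ge0$. Consider an unlimited sequence of channel uses for one packet, with i.i.d. uniform nonzero columns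 and independent erasures of probability $\epsilon$, and let $B$ be the number of channel uses needed to receive $k$ linearly independent symbols. Let $\epsilon_p=\mathbb P(B>n)$ be the packet erasure probability, and let $T$ be distributed as $B$ conditioned on $B\le n$. Then, almost surely, the average age exists and $$\lim_{\tau\to\infty}\frac1\tau\int_0^\tau\Delta(t)\,\mathrm dt=\mathbb E(T)-1+\frac{n(1+\epsilon_p)}{2(1-\epsilon_p)}.$$ -/

import Mathlib

open MeasureTheory ProbabilityTheory Filter Topology
open scoped ENNReal Matrix

namespace RandomLinearScheme

noncomputable section

/-- The coded symbols in the positions `R` contain `k` linearly independent ones: some `k` of the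
generator columns with index in `R` are linearly independent. -/
def Decodable {F : Type*} [Field F] {k : ℕ} {ι : Type*} (col : ι → Fin k → F) (R : Set ι) : Prop :=
  ∃ s : Fin k → ι, (∀ j, s j ∈ R) ∧ LinearIndependent F (fun j => col (s j))

/-! ### Encoder, channel, decoder for one packet -/

/-- The linear encoder `z = uᵀ G`. -/
def encode {F : Type*} [Field F] {k n : ℕ} (G : Matrix (Fin k) (Fin n) F) (u : Fin k → F) :
    Fin n → F :=
  u ᵥ* G

/-- The erasure channel: symbol `i` is erased (`none`) when `e i = true`, and is received
correctly otherwise. -/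
def channel {F : Type*} {n : ℕ} (e : Fin n → Bool) (z : Fin n → F) : Fin n → Option F :=
  fun i => if e i = true then none else some (z i)

/-- The positions among the first `m` ones that were not erased. -/
def receivedSet {F : Type*} {n : ℕ} (y : Fin n → Option F) (m : ℕ) : Set (Fin n) :=
  {i | (i : ℕ) < m ∧ (y i).isSome = true}

open Classical in
/-- The output of the on-the-fly decoder after the first `m` channel uses of a packet. If `k`
linearly independent coded symbols have been received, it outputs a message compatible with
the received symbols; otherwise it outputs nothing (`none`). -/
def decode {F : Type*} [Field F] {k n : ℕ} (G : Matrix (Fin k) (Fin n) F) (y : Fin n → Option F)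
    (m : ℕ) : Option (Fin k → F) :=
  if h : Decodable (fun i j => G j i) (receivedSet y m) ∧
      ∃ v : Fin k → F, ∀ i ∈ receivedSet y m, y i = some (encode G v i) then
    some h.2.choose
  else none

/-! ### The transmission policy and the age

Message `m` is generated at time `m`, and one channel use takes place at each time `0, 1, 2, …`.
Packet `l` carries the message `u (l * n)`, generated at time `l * n`; its symbols are sent, and
received without delay, at times `l * n, …, l * n + n - 1`. -/

/-- Packet `l` has been delivered by time `t`: for some channel use `i` of the packet, made no later
than `t`, the decoder has output the transmitted message after that channel use. -/
def DeliveredBy {F : Type*} [Field F] {k n : ℕ} (G : ℕ → Matrix (Fin k) (Fin n) F)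
    (e : ℕ → Fin n → Bool) (u : ℕ → Fin k → F) (l : ℕ) (t : ℝ) : Prop :=
  ∃ i : Fin n,
    decode (G l) (channel (e l) (encode (G l) (u (l * n)))) ((i : ℕ) + 1) = some (u (l * n)) ∧
    ((l * n + (i : ℕ) : ℕ) : ℝ) ≤ t

/-- The generation time of the freshest message delivered by time `t`. The receiver starts with an
update of age `a₀` at time `0`. -/
def freshest {F : Type*} [Field F] {k n : ℕ} (G : ℕ → Matrix (Fin k) (Fin n) F)
    (e : ℕ → Fin n → Bool) (u : ℕ → Fin k → F) (a₀ : ℝ) (t : ℝ) : ℝ :=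
  sSup (insert (-a₀) {s : ℝ | ∃ l : ℕ, DeliveredBy G e u l t ∧ s = ((l * n : ℕ) : ℝ)})

/-- The instantaneous age. -/
def age {F : Type*} [Field F] {k n : ℕ} (G : ℕ → Matrix (Fin k) (Fin n) F)
    (e : ℕ → Fin n → Bool) (u : ℕ → Fin k → F) (a₀ : ℝ) (t : ℝ) : ℝ :=
  t - freshest G e u a₀ t

/-- The age function `Δ` has time average `a`. -/
def HasAverageAge (Δ : ℝ → ℝ) (a : ℝ) : Prop :=
  (∀ τ : ℝ, 0 ≤ τ → IntervalIntegrable Δ volume 0 τ) ∧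
    Tendsto (fun τ : ℝ => (1 / τ) * ∫ t in (0 : ℝ)..τ, Δ t) atTop (𝓝 a)

/-! ### The randomness -/

/-- The law of the pair (generator column, erasure indicator) of one channel use: the column is
uniform on the nonzero vectors of `F ^ k`, and independently the symbol is erased with
probability `ε`. -/
def useLaw (F : Type*) [Field F] [MeasurableSpace F] (k : ℕ) (ε : unitInterval) :
    Measure ((Fin k → F) × Bool) :=
  (uniformOn {v : Fin k → F | v ≠ 0}).prod (bernoulliMeasure true false ε)

/-- The law of an unlimited i.i.d. sequence of channel uses for one packet. -/
def packetLaw (F : Type*) [Field F] [MeasurableSpace F] (k : ℕ) (ε : unitInterval) :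
    Measure (ℕ → (Fin k → F) × Bool) :=
  Measure.infinitePi (fun _ => useLaw F k ε)

/-- `B`: the number of channel uses until `k` linearly independent coded symbols are received
(`⊤` if this never happens). -/
def B {F : Type*} [Field F] {k : ℕ} (x : ℕ → (Fin k → F) × Bool) : ℕ∞ :=
  ⨅ (m : ℕ) (_ : Decodable (fun i => (x i).1) {i : ℕ | i < m ∧ (x i).2 = false}), (m : ℕ∞)

/-- The packet erasure probability `ε_p = P(B > n)`. -/
def erasureProb (F : Type*) [Field F] [MeasurableSpace F] (k n : ℕ) (ε : unitInterval) : ℝ :=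
  (packetLaw F k ε).real {x | (n : ℕ∞) < B x}

/-- `E(T)`, where `T` is distributed as `B` conditioned on `B ≤ n`. -/
def meanT (F : Type*) [Field F] [MeasurableSpace F] (k n : ℕ) (ε : unitInterval) : ℝ :=
  ∫ x, ((B x).toNat : ℝ) ∂((packetLaw F k ε)[|{x | B x ≤ (n : ℕ∞)}])

end

end RandomLinearScheme

/-!
The age at the start of slot `l` satisfies `A (l + 1) = n + (1 - I l) * A l`, where `I l` indicates
the delivery of packet `l`. If that packet is delivered a time `R l` before the end of its slot, the
age integrates to `n * A l + n ^ 2 / 2 - R l * A l` over the slot. Both `I l` and `R l` depend only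
on packet `l`, hence are independent of `A l`; so the products `(I l - E I) * A l` and
`(R l - E R) * A l` are centred, pairwise orthogonal and bounded in `L²`, and their averages tend to
`0` almost surely. Summing the recursion then shows that `A l` has average `n / p`, where
`p = E I = 1 - ε_p` is the delivery probability, and `E R = p * (n + 1 - E T)` because `R l` is
`n + 1 - B` for a packet delivered at its `B`-th channel use.
-/

namespace RandomLinearScheme

section StrongLaw

variable {Ω : Type*} {mΩ : MeasurableSpace Ω} {P : Measure Ω} {f Z : ℕ → Ω → ℝ} {K : ℝ}

lemma ae_tendsto_zero_of_summable_integral_sq (hf : ∀ m, MemLp (f m) 2 P)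
    (hs : Summable fun m => ∫ ω, f m ω ^ 2 ∂P) :
    ∀ᵐ ω ∂P, Tendsto (fun m => f m ω) atTop (𝓝 0) := by
  have hmeas : ∀ m, AEMeasurable (fun ω => ENNReal.ofReal (f m ω ^ 2)) P :=
    fun m => (hf m).integrable_sq.aemeasurable.ennreal_ofReal
  have hfin : ∫⁻ ω, ∑' m, ENNReal.ofReal (f m ω ^ 2) ∂P ≠ ⊤ := by
    rw [lintegral_tsum hmeas]
    simp_rw [← fun m => ofReal_integral_eq_lintegral_ofReal (hf m).integrable_sq
      (ae_of_all _ fun ω => sq_nonneg (f m ω))]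
    exact hs.tsum_ofReal_ne_top
  filter_upwards [ae_lt_top' (AEMeasurable.tsum hmeas) hfin] with ω hω
  have hsq : Tendsto (fun m => f m ω ^ 2) atTop (𝓝 0) := by
    simpa [Function.comp_def, ENNReal.toReal_ofReal, sq_nonneg] using
      (ENNReal.tendsto_toReal ENNReal.zero_ne_top).comp
        (ENNReal.tendsto_atTop_zero_of_tsum_ne_top hω.ne)
  rw [tendsto_zero_iff_abs_tendsto_zero]
  simpa [Real.sqrt_sq_eq_abs, Function.comp_def] using hsq.sqrt

lemma ae_tendsto_div_zero_of_summable {a : ℕ → ℝ} (hf : ∀ m, MemLp (f m) 2 P)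
    (hs : Summable fun m => (∫ ω, f m ω ^ 2 ∂P) / a m ^ 2) :
    ∀ᵐ ω ∂P, Tendsto (fun m => f m ω / a m) atTop (𝓝 0) :=
  ae_tendsto_zero_of_summable_integral_sq (fun m => by
      simpa only [div_eq_mul_inv] using (hf m).mul_const (a m)⁻¹)
    (by simpa only [div_pow, integral_div] using hs)

lemma ae_tendsto_div_zero_of_integral_sq_le (hf : ∀ l, MemLp (f l) 2 P)
    (hK : ∀ l, ∫ ω, f l ω ^ 2 ∂P ≤ K) :
    ∀ᵐ ω ∂P, Tendsto (fun l : ℕ => f l ω / l) atTop (𝓝 0) := by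
  refine ae_tendsto_div_zero_of_summable hf (.of_nonneg_of_le (fun m => by positivity)
    (fun m => ?_) ((Real.summable_one_div_nat_pow.2 one_lt_two).mul_left K))
  rw [mul_one_div]
  gcongr
  exact hK m

lemma ae_tendsto_div_sq_zero_of_integral_sq_le (hf : ∀ m, MemLp (f m) 2 P)
    (hK : ∀ m : ℕ, ∫ ω, f m ω ^ 2 ∂P ≤ K * (m + 1) ^ 2) :
    ∀ᵐ ω ∂P, Tendsto (fun m : ℕ => f m ω / (m : ℝ) ^ 2) atTop (𝓝 0) := by
  refine ae_tendsto_div_zero_of_summable hf (.of_nonneg_of_le (fun m => by positivity)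
    (fun m => ?_) ((Real.summable_one_div_nat_pow.2 one_lt_two).mul_left (4 * K)))
  rcases m.eq_zero_or_pos with rfl | hm
  · simp
  have hm' : (1 : ℝ) ≤ m := by exact_mod_cast hm
  have hK0 : 0 ≤ K := nonneg_of_mul_nonneg_left
    ((integral_nonneg fun ω => sq_nonneg (f 0 ω)).trans (hK 0)) (by positivity)
  calc (∫ ω, f m ω ^ 2 ∂P) / ((m : ℝ) ^ 2) ^ 2
      ≤ K * (m + m) ^ 2 / ((m : ℝ) ^ 2) ^ 2 := by
        gcongr
        exact (hK m).trans (by gcongr)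
    _ = 4 * K * (1 / (m : ℝ) ^ 2) := by field_simp; ring

lemma integral_sq_sum_of_orthogonal {ι : Type*} {Z : ι → Ω → ℝ} (hZ : ∀ i, MemLp (Z i) 2 P)
    (horth : Pairwise fun i j => ∫ ω, Z i ω * Z j ω ∂P = 0) (s : Finset ι) :
    ∫ ω, (∑ i ∈ s, Z i ω) ^ 2 ∂P = ∑ i ∈ s, ∫ ω, Z i ω ^ 2 ∂P := by
  have hint : ∀ i j, Integrable (fun ω => Z i ω * Z j ω) P :=
    fun i j => (hZ i).integrable_mul (hZ j)
  simp_rw [sq, Finset.sum_mul_sum]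
  rw [integral_finsetSum _ fun i _ => integrable_finsetSum _ fun j _ => hint i j]
  refine Finset.sum_congr rfl fun i hi => ?_
  rw [integral_finsetSum _ fun j _ => hint i j]
  exact Finset.sum_eq_single i (fun j _ hji => horth hji.symm) fun h => absurd hi h

lemma integral_sq_sum_abs_le {ι : Type*} {Z : ι → Ω → ℝ} (hZ : ∀ i, MemLp (Z i) 2 P)
    (hK : ∀ i, ∫ ω, Z i ω ^ 2 ∂P ≤ K) (s : Finset ι) :
    ∫ ω, (∑ i ∈ s, |Z i ω|) ^ 2 ∂P ≤ s.card ^ 2 * K := by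
  have hint : Integrable (fun ω => ∑ i ∈ s, Z i ω ^ 2) P :=
    integrable_finsetSum _ fun i _ => (hZ i).integrable_sq
  calc ∫ ω, (∑ i ∈ s, |Z i ω|) ^ 2 ∂P ≤ ∫ ω, s.card * ∑ i ∈ s, Z i ω ^ 2 ∂P :=
        integral_mono (memLp_finsetSum _ fun i _ => (hZ i).abs).integrable_sq
          (hint.const_mul _) fun ω => by
            simpa only [sq_abs] using sq_sum_le_card_mul_sum_sq (s := s) (f := fun i => |Z i ω|)
    _ = s.card * ∑ i ∈ s, ∫ ω, Z i ω ^ 2 ∂P := by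
        rw [integral_const_mul, integral_finsetSum _ fun i _ => (hZ i).integrable_sq]
    _ ≤ s.card * (s.card * K) := by
        gcongr
        simpa using Finset.sum_le_card_nsmul s _ K fun i _ => hK i
    _ = s.card ^ 2 * K := by ring

lemma tendsto_average_zero_of_tendsto_sq {z : ℕ → ℝ}
    (hsq : Tendsto (fun m : ℕ => (∑ l ∈ Finset.range (m ^ 2), z l) / (m : ℝ) ^ 2) atTop (𝓝 0))
    (hgap : Tendsto (fun m : ℕ => (∑ l ∈ Finset.Ico (m ^ 2) ((m + 1) ^ 2), |z l|) / (m : ℝ) ^ 2)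
      atTop (𝓝 0)) :
    Tendsto (fun N : ℕ => (∑ l ∈ Finset.range N, z l) / N) atTop (𝓝 0) := by
  have hsqrt : Tendsto Nat.sqrt atTop atTop :=
    tendsto_atTop_atTop.2 fun b => ⟨b ^ 2, fun N hN => Nat.le_sqrt'.2 hN⟩
  have hbound := (hsq.abs.add hgap).comp hsqrt
  rw [abs_zero, add_zero] at hbound
  refine squeeze_zero_norm' ((eventually_ge_atTop 1).mono fun N hN => ?_) hbound
  set m := N.sqrt
  have : 0 < m := Nat.sqrt_pos.2 hN
  have hmN : m ^ 2 ≤ N := Nat.sqrt_le' N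
  have hNm : N ≤ (m + 1) ^ 2 := (Nat.lt_succ_sqrt' N).le
  have hsum : |∑ l ∈ Finset.range N, z l| ≤ |∑ l ∈ Finset.range (m ^ 2), z l| +
      ∑ l ∈ Finset.Ico (m ^ 2) ((m + 1) ^ 2), |z l| := by
    rw [← Finset.sum_range_add_sum_Ico z hmN]
    refine (abs_add_le _ _).trans (add_le_add_right ?_ _)
    exact (Finset.abs_sum_le_sum_abs _ _).trans (Finset.sum_le_sum_of_subset_of_nonneg
      (Finset.Ico_subset_Ico_right hNm) fun l _ _ => abs_nonneg _)
  rw [Real.norm_eq_abs, abs_div, Nat.abs_cast]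
  calc _ ≤ (|∑ l ∈ Finset.range (m ^ 2), z l| +
        ∑ l ∈ Finset.Ico (m ^ 2) ((m + 1) ^ 2), |z l|) / (m : ℝ) ^ 2 := by
        gcongr
        exact_mod_cast hmN
    _ = _ := by simp [add_div, abs_div, m]

theorem strong_law_of_orthogonal (hZ : ∀ l, MemLp (Z l) 2 P)
    (horth : Pairwise fun i j => ∫ ω, Z i ω * Z j ω ∂P = 0) (hK : ∀ l, ∫ ω, Z l ω ^ 2 ∂P ≤ K) :
    ∀ᵐ ω ∂P, Tendsto (fun N : ℕ => (∑ l ∈ Finset.range N, Z l ω) / N) atTop (𝓝 0) := by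
  have hK0 : 0 ≤ K := (integral_nonneg fun ω => sq_nonneg (Z 0 ω)).trans (hK 0)
  have hsq := ae_tendsto_div_sq_zero_of_integral_sq_le (P := P) (K := K)
    (f := fun m ω => ∑ l ∈ Finset.range (m ^ 2), Z l ω)
    (fun m => memLp_finsetSum _ fun l _ => hZ l) fun m => by
      rw [integral_sq_sum_of_orthogonal hZ horth]
      calc _ ≤ (Finset.range (m ^ 2)).card • K := Finset.sum_le_card_nsmul _ _ K fun l _ => hK l
        _ = K * (m : ℝ) ^ 2 := by simp [mul_comm]
        _ ≤ K * (m + 1) ^ 2 := by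
            gcongr
            linarith
  have hgap := ae_tendsto_div_sq_zero_of_integral_sq_le (P := P) (K := 4 * K)
    (f := fun m ω => ∑ l ∈ Finset.Ico (m ^ 2) ((m + 1) ^ 2), |Z l ω|)
    (fun m => memLp_finsetSum _ fun l _ => (hZ l).abs) fun m => by
      have hcard : ((m + 1) ^ 2 - m ^ 2 : ℕ) ≤ 2 * (m + 1) := by
        rw [Nat.sub_le_iff_le_add]
        nlinarith
      calc _ ≤ (((m + 1) ^ 2 - m ^ 2 : ℕ) : ℝ) ^ 2 * K := by
            simpa only [Nat.card_Ico] using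
              integral_sq_sum_abs_le hZ hK (Finset.Ico (m ^ 2) ((m + 1) ^ 2))
        _ ≤ (2 * (m + 1)) ^ 2 * K := by
            gcongr
            exact_mod_cast hcard
        _ = 4 * K * (m + 1) ^ 2 := by ring
  filter_upwards [hsq, hgap] with ω hω hω'
  exact tendsto_average_zero_of_tendsto_sq hω hω'

end StrongLaw

section Innovation

variable {Ω E E' : Type*} {mΩ : MeasurableSpace Ω} [MeasurableSpace E] [MeasurableSpace E']
  {P : Measure Ω}

/-- `X` is driven by fresh randomness along the filtration `ℱ`: the variable `X l` is independent of
`ℱ l` and is revealed at the next time `l + 1`. -/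
structure IsInnovation (ℱ : Filtration ℕ mΩ) (X : ℕ → Ω → E) (P : Measure Ω) : Prop where
  measurable_succ : ∀ l, Measurable[ℱ (l + 1)] (X l)
  indep : ∀ l, Indep (ℱ l) (MeasurableSpace.comap (X l) inferInstance) P

/-- The filtration of the strict past of `X`: its member at time `l` is generated by the `X i` with
`i < l`. -/
def pastFiltration (X : ℕ → Ω → E) (hX : ∀ l, Measurable (X l)) : Filtration ℕ mΩ where
  seq l := ⨆ i ∈ Set.Iio l, MeasurableSpace.comap (X i) inferInstance
  mono' _ _ hlm := biSup_mono fun _ hi => lt_of_lt_of_le hi hlm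
  le' _ := iSup₂_le fun i _ => (hX i).comap_le

lemma isInnovation_pastFiltration {X : ℕ → Ω → E} (hX : ∀ l, Measurable (X l))
    (hind : iIndepFun X P) : IsInnovation (pastFiltration X hX) X P where
  measurable_succ l := measurable_iff_comap_le.2 <|
    le_biSup (fun i => MeasurableSpace.comap (X i) inferInstance) (Set.mem_Iio.2 l.lt_succ_self)
  indep l := by
    have h := indep_iSup_of_disjoint (fun i => (hX i).comap_le) hind.iIndep
      (S := Set.Iio l) (T := {l}) (by simp)
    rwa [iSup_singleton] at h

namespace IsInnovation

variable {ℱ : Filtration ℕ mΩ}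

lemma measurable {X : ℕ → Ω → E} (hX : IsInnovation ℱ X P) (l : ℕ) : Measurable (X l) :=
  (hX.measurable_succ l).mono (ℱ.le _) le_rfl

lemma comp {X : ℕ → Ω → E} (hX : IsInnovation ℱ X P) {g : E → E'} (hg : Measurable g) :
    IsInnovation ℱ (fun l ω => g (X l ω)) P where
  measurable_succ l := hg.comp (hX.measurable_succ l)
  indep l := indep_of_indep_of_le_right (hX.indep l) <| by
    rintro _ ⟨s, hs, rfl⟩
    exact ⟨g ⁻¹' s, hg hs, rfl⟩

lemma integral_mul {X : ℕ → Ω → ℝ} (hX : IsInnovation ℱ X P) {l : ℕ} {W : Ω → ℝ}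
    (hW : Measurable[ℱ l] W) : ∫ ω, W ω * X l ω ∂P = (∫ ω, W ω ∂P) * ∫ ω, X l ω ∂P := by
  have hindep : IndepFun W (X l) P := (IndepFun_iff_Indep W (X l) P).2
    (indep_of_indep_of_le_left (hX.indep l) hW.comap_le)
  exact hindep.integral_fun_mul_eq_mul_integral
    (hW.mono (ℱ.le l) le_rfl).aestronglyMeasurable (hX.measurable l).aestronglyMeasurable

end IsInnovation

variable {ℱ : Filtration ℕ mΩ} {X A : ℕ → Ω → ℝ} {K M r : ℝ}

lemma integral_mul_eq_zero_of_isInnovation (hX : IsInnovation ℱ X P)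
    (hmean : ∀ l, ∫ ω, X l ω ∂P = 0) (hA : Adapted ℱ A) :
    Pairwise fun i j => ∫ ω, (X i ω * A i ω) * (X j ω * A j ω) ∂P = 0 := by
  have hlt : ∀ i j, i < j → ∫ ω, (X i ω * A i ω) * (X j ω * A j ω) ∂P = 0 := by
    intro i j hij
    have hXi : Measurable[ℱ j] (X i) := (hX.measurable_succ i).mono (ℱ.mono hij) le_rfl
    have h := hX.integral_mul ((hXi.mul (hA.measurable_le hij.le)).mul (hA j))
    rw [hmean, mul_zero] at h
    rw [← h]
    congr with ω
    simp only [Pi.mul_apply]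
    ring
  intro i j hij
  rcases hij.lt_or_gt with h | h
  · exact hlt i j h
  · rw [← hlt j i h]
    congr with ω
    ring

theorem ae_tendsto_average_mul_zero (hX : IsInnovation ℱ X P) (hM : ∀ l ω, |X l ω| ≤ M)
    (hmean : ∀ l, ∫ ω, X l ω ∂P = 0) (hA : Adapted ℱ A) (hA₂ : ∀ l, MemLp (A l) 2 P)
    (hK : ∀ l, ∫ ω, A l ω ^ 2 ∂P ≤ K) :
    ∀ᵐ ω ∂P, Tendsto (fun N : ℕ => (∑ l ∈ Finset.range N, X l ω * A l ω) / N) atTop (𝓝 0) := by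
  have hle : ∀ l ω, |X l ω * A l ω| ≤ M * |A l ω| := fun l ω => by
    rw [abs_mul]
    gcongr
    exact hM l ω
  have hXA : ∀ l, MemLp (fun ω => X l ω * A l ω) 2 P := fun l =>
    (hA₂ l).of_le_mul ((hX.measurable l).aestronglyMeasurable.mul (hA₂ l).1)
      (ae_of_all _ (hle l))
  refine strong_law_of_orthogonal hXA (integral_mul_eq_zero_of_isInnovation hX hmean hA)
    (K := M ^ 2 * K) fun l => ?_
  calc ∫ ω, (X l ω * A l ω) ^ 2 ∂P ≤ ∫ ω, M ^ 2 * A l ω ^ 2 ∂P :=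
        integral_mono (hXA l).integrable_sq ((hA₂ l).integrable_sq.const_mul _) fun ω => by
          have h := pow_le_pow_left₀ (abs_nonneg _) (hle l ω) 2
          rwa [mul_pow, sq_abs, sq_abs] at h
    _ ≤ M ^ 2 * K := by
        rw [integral_const_mul]
        gcongr
        exact hK l

theorem ae_tendsto_average_sub_mul_zero [IsProbabilityMeasure P] (hX : IsInnovation ℱ X P)
    (hM : ∀ l ω, |X l ω| ≤ M) (hmean : ∀ l, ∫ ω, X l ω ∂P = r) (hA : Adapted ℱ A)
    (hA₂ : ∀ l, MemLp (A l) 2 P) (hK : ∀ l, ∫ ω, A l ω ^ 2 ∂P ≤ K) :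
    ∀ᵐ ω ∂P, Tendsto (fun N : ℕ => (∑ l ∈ Finset.range N, (X l ω - r) * A l ω) / N) atTop
      (𝓝 0) := by
  refine ae_tendsto_average_mul_zero (M := M + |r|) (hX.comp (measurable_id.sub_const r))
    (fun l ω => (abs_sub _ _).trans (by gcongr; exact hM l ω)) (fun l => ?_) hA hA₂ hK
  have hint : Integrable (X l) P :=
    .of_bound (hX.measurable l).aestronglyMeasurable M (ae_of_all _ (hM l))
  simp [integral_sub hint (integrable_const r), hmean]

end Innovation

section StartAge

/-- The age at the beginning of each slot of length `n`: a delivery in the preceding slot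
(`I l = 1`) resets it to `n`, and otherwise (`I l = 0`) it grows by `n`. -/
def startAge (n a₀ : ℝ) (I : ℕ → ℝ) : ℕ → ℝ
  | 0 => a₀
  | l + 1 => n + (1 - I l) * startAge n a₀ I l

variable {n a₀ : ℝ} {I : ℕ → ℝ}

lemma startAge_nonneg (hn : 0 ≤ n) (ha₀ : 0 ≤ a₀) (hI₁ : ∀ l, I l ≤ 1) (l : ℕ) :
    0 ≤ startAge n a₀ I l := by
  induction l with
  | zero => exact ha₀
  | succ l ih => exact add_nonneg hn (mul_nonneg (sub_nonneg.2 (hI₁ l)) ih)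

lemma startAge_le (hn : 0 ≤ n) (ha₀ : 0 ≤ a₀) (hI₀ : ∀ l, 0 ≤ I l) (hI₁ : ∀ l, I l ≤ 1) (l : ℕ) :
    startAge n a₀ I l ≤ a₀ + n * l := by
  induction l with
  | zero => simp [startAge]
  | succ l ih =>
    have := mul_nonneg (hI₀ l) (startAge_nonneg hn ha₀ hI₁ l)
    simp only [startAge]
    push_cast
    linarith

lemma sum_mul_startAge (n a₀ : ℝ) (I : ℕ → ℝ) (L : ℕ) :
    ∑ l ∈ Finset.range L, I l * startAge n a₀ I l = n * L + a₀ - startAge n a₀ I L := by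
  induction L with
  | zero => simp [startAge]
  | succ L ih =>
    rw [Finset.sum_range_succ, ih]
    simp only [startAge]
    push_cast
    ring

lemma startAge_succ_sq_le {p : ℝ} (hp : 0 < p) (hI₀ : ∀ l, 0 ≤ I l) (hI₁ : ∀ l, I l ≤ 1)
    (hn : 0 ≤ n) (ha₀ : 0 ≤ a₀) (l : ℕ) :
    startAge n a₀ I (l + 1) ^ 2 ≤
      n ^ 2 + 2 * n ^ 2 / p + (p / 2 * startAge n a₀ I l ^ 2 +
        startAge n a₀ I l ^ 2 * (1 - I l)) := by
  simp only [startAge]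
  set a := startAge n a₀ I l
  have ha : 0 ≤ a := startAge_nonneg hn ha₀ hI₁ l
  have hcross : 2 * n * a ≤ 2 * n ^ 2 / p + p / 2 * a ^ 2 := by
    rw [div_add' _ _ _ hp.ne', le_div_iff₀ hp]
    nlinarith [sq_nonneg (2 * n - p * a)]
  have hcross' : 2 * n * ((1 - I l) * a) ≤ 2 * n * a := by
    gcongr
    exact mul_le_of_le_one_left ha (sub_le_self _ (hI₀ l))
  have hsq : ((1 - I l) * a) ^ 2 ≤ a ^ 2 * (1 - I l) := by
    nlinarith [mul_nonneg (hI₀ l) (mul_nonneg (sub_nonneg.2 (hI₁ l)) (sq_nonneg a))]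
  linarith [add_sq n ((1 - I l) * a)]

lemma le_of_le_add_one_sub_mul {v : ℕ → ℝ} {C q : ℝ} (hC : 0 ≤ C) (hq : 0 < q) (hq₁ : q ≤ 1)
    (hv₀ : 0 ≤ v 0) (hv : ∀ l, v (l + 1) ≤ C + (1 - q) * v l) (l : ℕ) : v l ≤ v 0 + C / q := by
  induction l with
  | zero => exact le_add_of_nonneg_right (by positivity)
  | succ l ih =>
    calc v (l + 1) ≤ C + (1 - q) * (v 0 + C / q) :=
          (hv l).trans (by gcongr)
      _ = v 0 + C / q - q * v 0 := by field_simp; ring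
      _ ≤ v 0 + C / q := sub_le_self _ (by positivity)

section Random

variable {Ω : Type*} {mΩ : MeasurableSpace Ω} {P : Measure Ω} {ℱ : Filtration ℕ mΩ}
  {I : ℕ → Ω → ℝ} {p : ℝ}

lemma adapted_startAge (hI : ∀ l, Measurable[ℱ (l + 1)] (I l)) (n a₀ : ℝ) :
    Adapted ℱ fun l ω => startAge n a₀ (I · ω) l := by
  intro l
  induction l with
  | zero => exact measurable_const
  | succ l ih =>
    exact (((hI l).const_sub 1).mul (ih.mono (ℱ.mono l.le_succ) le_rfl)).const_add n

variable [IsProbabilityMeasure P]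

lemma integrable_of_mem_unitInterval {X : Ω → ℝ} (hX : Measurable X) (hX₀ : ∀ ω, 0 ≤ X ω)
    (hX₁ : ∀ ω, X ω ≤ 1) : Integrable X P :=
  .of_bound hX.aestronglyMeasurable 1 (ae_of_all _ fun ω =>
    (Real.norm_of_nonneg (hX₀ ω)).trans_le (hX₁ ω))

lemma memLp_startAge (hI : ∀ l, Measurable (I l)) (hI₀ : ∀ l ω, 0 ≤ I l ω)
    (hI₁ : ∀ l ω, I l ω ≤ 1) (hn : 0 ≤ n) (ha₀ : 0 ≤ a₀) (l : ℕ) :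
    MemLp (fun ω => startAge n a₀ (I · ω) l) 2 P := by
  have hmeas : Measurable fun ω => startAge n a₀ (I · ω) l := by
    induction l with
    | zero => exact measurable_const
    | succ l ih => exact ((hI l).const_sub 1 |>.mul ih).const_add n
  refine .of_bound hmeas.aestronglyMeasurable (a₀ + n * l) (ae_of_all _ fun ω => ?_)
  rw [Real.norm_of_nonneg (startAge_nonneg hn ha₀ (hI₁ · ω) l)]
  exact startAge_le hn ha₀ (hI₀ · ω) (hI₁ · ω) l

lemma integral_startAge_succ_sq_le (hI : IsInnovation ℱ I P) (hI₀ : ∀ l ω, 0 ≤ I l ω)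
    (hI₁ : ∀ l ω, I l ω ≤ 1) (hp : 0 < p) (hmean : ∀ l, ∫ ω, I l ω ∂P = p)
    (hn : 0 ≤ n) (ha₀ : 0 ≤ a₀) (l : ℕ) :
    ∫ ω, startAge n a₀ (I · ω) (l + 1) ^ 2 ∂P ≤
      n ^ 2 + 2 * n ^ 2 / p + (1 - p / 2) * ∫ ω, startAge n a₀ (I · ω) l ^ 2 ∂P := by
  have hA₂ := memLp_startAge (P := P) hI.measurable hI₀ hI₁ hn ha₀
  have hA := (hA₂ l).integrable_sq
  have hI_int := integrable_of_mem_unitInterval (P := P) (hI.measurable l) (hI₀ l) (hI₁ l)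
  have hAI : Integrable (fun ω => startAge n a₀ (I · ω) l ^ 2 * (1 - I l ω)) P :=
    hA.mul_bdd (c := 1) ((integrable_const 1).sub hI_int).1 (ae_of_all _ fun ω => by
      rw [Real.norm_of_nonneg (sub_nonneg.2 (hI₁ l ω))]
      exact sub_le_self _ (hI₀ l ω))
  have hprod : ∫ ω, startAge n a₀ (I · ω) l ^ 2 * (1 - I l ω) ∂P =
      (∫ ω, startAge n a₀ (I · ω) l ^ 2 ∂P) * (1 - p) := by
    have h := (hI.comp (g := fun x => 1 - x) (by fun_prop)).integral_mul
      ((adapted_startAge hI.measurable_succ n a₀ l).pow_const 2)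
    simpa [integral_sub (integrable_const 1) hI_int, hmean] using h
  have hsum : Integrable (fun ω => p / 2 * startAge n a₀ (I · ω) l ^ 2 +
      startAge n a₀ (I · ω) l ^ 2 * (1 - I l ω)) P := (hA.const_mul (p / 2)).add hAI
  calc _ ≤ ∫ ω, (n ^ 2 + 2 * n ^ 2 / p + (p / 2 * startAge n a₀ (I · ω) l ^ 2 +
        startAge n a₀ (I · ω) l ^ 2 * (1 - I l ω))) ∂P :=
        integral_mono (hA₂ (l + 1)).integrable_sq ((integrable_const _).add hsum) fun ω =>
          startAge_succ_sq_le hp (hI₀ · ω) (hI₁ · ω) hn ha₀ l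
    _ = _ := by
        rw [integral_add (integrable_const _) hsum, integral_add (hA.const_mul _) hAI, hprod,
          integral_const_mul, integral_const, probReal_univ, one_smul]
        ring

lemma integral_startAge_sq_le (hI : IsInnovation ℱ I P) (hI₀ : ∀ l ω, 0 ≤ I l ω)
    (hI₁ : ∀ l ω, I l ω ≤ 1) (hp : 0 < p) (hmean : ∀ l, ∫ ω, I l ω ∂P = p)
    (hn : 0 ≤ n) (ha₀ : 0 ≤ a₀) (l : ℕ) :
    ∫ ω, startAge n a₀ (I · ω) l ^ 2 ∂P ≤ a₀ ^ 2 + (n ^ 2 + 2 * n ^ 2 / p) / (p / 2) := by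
  have hp₁ : p ≤ 1 := by
    simpa [hmean] using integral_mono (μ := P)
      (integrable_of_mem_unitInterval (hI.measurable 0) (hI₀ 0) (hI₁ 0)) (integrable_const 1)
      (hI₁ 0)
  simpa [startAge] using le_of_le_add_one_sub_mul
    (v := fun l => ∫ ω, startAge n a₀ (I · ω) l ^ 2 ∂P) (by positivity) (half_pos hp)
    (by linarith) (integral_nonneg fun ω => sq_nonneg _)
    (integral_startAge_succ_sq_le hI hI₀ hI₁ hp hmean hn ha₀) l

theorem ae_tendsto_average_startAge (hI : IsInnovation ℱ I P) (hI₀ : ∀ l ω, 0 ≤ I l ω)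
    (hI₁ : ∀ l ω, I l ω ≤ 1) (hp : 0 < p) (hmean : ∀ l, ∫ ω, I l ω ∂P = p)
    (hn : 0 ≤ n) (ha₀ : 0 ≤ a₀) :
    ∀ᵐ ω ∂P, Tendsto (fun L : ℕ => (∑ l ∈ Finset.range L, startAge n a₀ (I · ω) l) / L) atTop
      (𝓝 (n / p)) := by
  have hA₂ := memLp_startAge (P := P) hI.measurable hI₀ hI₁ hn ha₀
  have hK := integral_startAge_sq_le hI hI₀ hI₁ hp hmean hn ha₀
  have hcentred := ae_tendsto_average_sub_mul_zero (M := 1) hI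
    (fun l ω => (abs_of_nonneg (hI₀ l ω)).trans_le (hI₁ l ω)) hmean
    (adapted_startAge hI.measurable_succ n a₀) hA₂ hK
  filter_upwards [hcentred, ae_tendsto_div_zero_of_integral_sq_le hA₂ hK] with ω hω hlast
  have hlim := (((tendsto_const_nhds (x := n)).add (tendsto_const_div_atTop_nhds_zero_nat a₀)).sub
    (hlast.add hω)).div_const p
  simp only [add_zero, sub_zero] at hlim
  refine hlim.congr' ((eventually_gt_atTop 0).mono fun L hL => ?_)
  have hL' : (L : ℝ) ≠ 0 := by exact_mod_cast hL.ne'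
  simp_rw [sub_mul, Finset.sum_sub_distrib, ← Finset.mul_sum, sum_mul_startAge]
  field_simp
  ring

theorem ae_tendsto_average_mul_startAge (hI : IsInnovation ℱ I P) (hI₀ : ∀ l ω, 0 ≤ I l ω)
    (hI₁ : ∀ l ω, I l ω ≤ 1) (hp : 0 < p) (hmean : ∀ l, ∫ ω, I l ω ∂P = p)
    (hn : 0 ≤ n) (ha₀ : 0 ≤ a₀) {X : ℕ → Ω → ℝ} {M r : ℝ} (hX : IsInnovation ℱ X P)
    (hM : ∀ l ω, |X l ω| ≤ M) (hXmean : ∀ l, ∫ ω, X l ω ∂P = r) :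
    ∀ᵐ ω ∂P, Tendsto (fun L : ℕ => (∑ l ∈ Finset.range L, X l ω * startAge n a₀ (I · ω) l) / L)
      atTop (𝓝 (r * (n / p))) := by
  have hcentred := ae_tendsto_average_sub_mul_zero hX hM hXmean
    (adapted_startAge hI.measurable_succ n a₀)
    (memLp_startAge hI.measurable hI₀ hI₁ hn ha₀)
    (integral_startAge_sq_le hI hI₀ hI₁ hp hmean hn ha₀)
  filter_upwards [hcentred, ae_tendsto_average_startAge hI hI₀ hI₁ hp hmean hn ha₀] with ω hω hA
  have hlim := hω.add (hA.const_mul r)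
  rw [zero_add] at hlim
  refine hlim.congr fun L => ?_
  simp_rw [sub_mul, Finset.sum_sub_distrib, ← Finset.mul_sum]
  ring

end Random

end StartAge

section TimeAverage

lemma tendsto_div_of_tendsto_natCast_div {Φ : ℝ → ℝ} {γ : ℝ} (hΦ : MonotoneOn Φ (Set.Ici 0))
    (hlim : Tendsto (fun L : ℕ => Φ L / L) atTop (𝓝 γ)) :
    Tendsto (fun x => Φ x / x) atTop (𝓝 γ) := by
  have hfloor := (hlim.comp tendsto_nat_floor_atTop).mul (tendsto_nat_floor_div_atTop (R := ℝ))
  have hceil := (hlim.comp tendsto_nat_ceil_atTop).mul (tendsto_nat_ceil_div_atTop (R := ℝ))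
  rw [mul_one] at hfloor hceil
  refine tendsto_of_tendsto_of_tendsto_of_le_of_le' hfloor hceil ?_ ?_ <;>
    filter_upwards [eventually_ge_atTop 1] with x hx <;>
    have hx₀ : 0 < x := zero_lt_one.trans_le hx
  · have hne : (⌊x⌋₊ : ℝ) ≠ 0 := by exact_mod_cast (Nat.floor_pos.2 hx).ne'
    rw [Function.comp_apply, div_mul_div_cancel₀ hne]
    gcongr
    exact hΦ (Set.mem_Ici.2 (by positivity)) hx₀.le (Nat.floor_le hx₀.le)
  · have hne : (⌈x⌉₊ : ℝ) ≠ 0 := by exact_mod_cast (Nat.ceil_pos.2 hx₀).ne'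
    rw [Function.comp_apply, div_mul_div_cancel₀ hne]
    gcongr
    exact hΦ hx₀.le (Set.mem_Ici.2 (by positivity)) (Nat.le_ceil x)

lemma hasAverageAge_of_tendsto_average_slots {Δ : ℝ → ℝ} {n γ : ℝ} {c : ℕ → ℝ} (hn : 0 < n)
    (hΔ : ∀ t, 0 ≤ t → 0 ≤ Δ t)
    (hint : ∀ l : ℕ, IntervalIntegrable Δ volume (l * n) ((l + 1 : ℕ) * n))
    (hc : ∀ l : ℕ, ∫ t in (l * n : ℝ)..((l + 1 : ℕ) * n), Δ t = c l)
    (hlim : Tendsto (fun L : ℕ => (∑ l ∈ Finset.range L, c l) / L) atTop (𝓝 γ)) :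
    HasAverageAge Δ (γ / n) := by
  have hint_slots : ∀ L : ℕ, IntervalIntegrable Δ volume 0 (L * n) := fun L => by
    simpa using IntervalIntegrable.trans_iterate (a := fun l : ℕ => (l * n : ℝ)) (n := L)
      fun l _ => hint l
  have hsum : ∀ L : ℕ, ∫ t in (0 : ℝ)..L * n, Δ t = ∑ l ∈ Finset.range L, c l := fun L => by
    have h := intervalIntegral.sum_integral_adjacent_intervals (f := Δ) (μ := volume)
      (a := fun l : ℕ => (l * n : ℝ)) (n := L) fun l _ => hint l
    simp only [hc, Nat.cast_zero, zero_mul] at h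
    exact h.symm
  have hint₀ : ∀ τ : ℝ, 0 ≤ τ → IntervalIntegrable Δ volume 0 τ := fun τ hτ => by
    refine (hint_slots ⌈τ / n⌉₊).mono_set ?_
    rw [Set.uIcc_of_le hτ, Set.uIcc_of_le (by positivity)]
    exact Set.Icc_subset_Icc_right ((div_le_iff₀ hn).1 (Nat.le_ceil (τ / n)))
  have hmono : MonotoneOn (fun x => ∫ t in (0 : ℝ)..x * n, Δ t) (Set.Ici 0) := by
    intro x hx y hy hxy
    exact intervalIntegral.integral_mono_interval le_rfl (mul_nonneg hx hn.le) (by gcongr)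
      ((ae_restrict_iff' measurableSet_Ioc).2 (ae_of_all _ fun t ht => hΔ t ht.1.le))
      (hint₀ _ (mul_nonneg hy hn.le))
  have hlim_slots := tendsto_div_of_tendsto_natCast_div hmono (by simpa only [hsum] using hlim)
  refine ⟨hint₀, ((hlim_slots.comp (tendsto_id.atTop_div_const hn)).div_const n).congr' ?_⟩
  filter_upwards [eventually_gt_atTop 0] with τ hτ
  simp only [Function.comp_apply, id_eq, div_mul_cancel₀ _ hn.ne']
  field_simp

lemma intervalIntegral_congr_Ico {f g : ℝ → ℝ} {a b : ℝ} (hab : a ≤ b)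
    (hg : IntervalIntegrable g volume a b) (h : ∀ t ∈ Set.Ico a b, f t = g t) :
    IntervalIntegrable f volume a b ∧ ∫ t in a..b, f t = ∫ t in a..b, g t := by
  have hae : f =ᵐ[volume.restrict (Set.Ioc a b)] g := by
    rw [← Measure.restrict_congr_set Ico_ae_eq_Ioc]
    filter_upwards [ae_restrict_mem measurableSet_Ico] with t ht using h t ht
  rw [intervalIntegrable_iff_integrableOn_Ioc_of_le hab] at hg ⊢
  rw [intervalIntegral.integral_of_le hab, intervalIntegral.integral_of_le hab]
  exact ⟨hg.congr hae.symm, integral_congr_ae hae⟩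

lemma integral_sawtooth {Δ : ℝ → ℝ} {c d r A : ℝ} (hcr : c ≤ d - r) (hr : 0 ≤ r)
    (hΔ : ∀ t ∈ Set.Ico c d, Δ t = t - c + if d - r ≤ t then 0 else A) :
    IntervalIntegrable Δ volume c d ∧
      ∫ t in c..d, Δ t = (d - c) * A + (d - c) ^ 2 / 2 - r * A := by
  have hlin : ∀ a b B : ℝ, ∫ t in a..b, (t - c + B) =
      (b ^ 2 - a ^ 2) / 2 - (b - a) * (c - B) := fun a b B => by
    simp_rw [sub_add]
    rw [intervalIntegral.integral_sub (by simp) (by simp), integral_id,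
      intervalIntegral.integral_const, smul_eq_mul]
  have hcont : ∀ a b B : ℝ, IntervalIntegrable (fun t => t - c + B) volume a b := fun a b B =>
    Continuous.intervalIntegrable (by fun_prop) a b
  obtain ⟨hint₁, hval₁⟩ := intervalIntegral_congr_Ico (f := Δ) hcr (hcont _ _ A) fun t ht => by
    rw [hΔ t ⟨ht.1, ht.2.trans_le (sub_le_self d hr)⟩, if_neg ht.2.not_ge]
  obtain ⟨hint₂, hval₂⟩ := intervalIntegral_congr_Ico (f := Δ) (sub_le_self d hr) (hcont _ _ 0)
    fun t ht => by rw [hΔ t ⟨hcr.trans ht.1, ht.2⟩, if_pos ht.1]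
  refine ⟨hint₁.trans hint₂, ?_⟩
  rw [← intervalIntegral.integral_add_adjacent_intervals hint₁ hint₂, hval₁, hval₂, hlin, hlin]
  ring

end TimeAverage

section SlottedAge

/-- The age process of packets sent in slots of length `n`: packet `j` is generated at time `j * n`
and delivered `R j` before the end of its slot, where `R j = 0` means that it is lost. -/
noncomputable def slottedAge (n a₀ : ℝ) (R : ℕ → ℝ) (t : ℝ) : ℝ :=
  t - sSup (insert (-a₀) {s | ∃ j : ℕ, (0 < R j ∧ (j + 1) * n - R j ≤ t) ∧ s = j * n})

/-- The indicator of a delivery with residual time `r`, a residual time of `0` meaning a loss. -/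
noncomputable def deliveryIndicator (r : ℝ) : ℝ :=
  (Set.Ioi 0).indicator 1 r

lemma deliveryIndicator_nonneg (r : ℝ) : 0 ≤ deliveryIndicator r :=
  Set.indicator_nonneg (fun _ _ => zero_le_one) r

lemma deliveryIndicator_le_one (r : ℝ) : deliveryIndicator r ≤ 1 :=
  Set.indicator_le_self' (fun _ _ => zero_le_one) r

lemma measurable_deliveryIndicator : Measurable deliveryIndicator :=
  measurable_one.indicator measurableSet_Ioi

variable {n a₀ : ℝ} {R : ℕ → ℝ}

lemma isGreatest_sub_startAge (hn : 0 ≤ n) (ha₀ : 0 ≤ a₀) (l : ℕ) :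
    IsGreatest (insert (-a₀) {s : ℝ | ∃ j < l, 0 < R j ∧ s = j * n})
      (l * n - startAge n a₀ (fun j => deliveryIndicator (R j)) l) := by
  set I := fun j => deliveryIndicator (R j) with hI
  induction l with
  | zero => simp [startAge, isGreatest_singleton]
  | succ l ih =>
    by_cases hR : 0 < R l
    · have hlast : ((l + 1 : ℕ) : ℝ) * n - startAge n a₀ I (l + 1) = l * n := by
        simp [startAge, hI, deliveryIndicator, hR]
        ring
      rw [hlast]
      refine ⟨Or.inr ⟨l, l.lt_succ_self, hR, rfl⟩, ?_⟩
      rintro s (rfl | ⟨j, hj, -, rfl⟩)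
      · exact (neg_nonpos.2 ha₀).trans (by positivity)
      · gcongr
        exact Nat.le_of_lt_succ hj
    · have hsame : ((l + 1 : ℕ) : ℝ) * n - startAge n a₀ I (l + 1) =
          l * n - startAge n a₀ I l := by
        simp [startAge, hI, deliveryIndicator, hR]
        ring
      rw [hsame]
      convert ih using 6 with s j
      refine ⟨fun ⟨hj, hRj, hs⟩ => ⟨?_, hRj, hs⟩,
        fun ⟨hj, hRj, hs⟩ => ⟨hj.trans l.lt_succ_self, hRj, hs⟩⟩
      exact lt_of_le_of_ne (Nat.le_of_lt_succ hj) fun h => hR (h ▸ hRj)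

lemma slottedAge_nonneg (ha₀ : 0 ≤ a₀) (hRn : ∀ j, R j ≤ n) {t : ℝ} (ht : 0 ≤ t) :
    0 ≤ slottedAge n a₀ R t := by
  refine sub_nonneg.2 (csSup_le (Set.insert_nonempty _ _) ?_)
  rintro s (rfl | ⟨j, ⟨-, hj⟩, rfl⟩)
  · linarith
  · linarith [hRn j]

lemma slottedAge_eq (hn : 0 < n) (ha₀ : 0 ≤ a₀) (hRn : ∀ j, R j ≤ n) {l : ℕ} {t : ℝ}
    (ht : t ∈ Set.Ico (l * n) ((l + 1) * n)) :
    slottedAge n a₀ R t = t - l * n + if (l + 1) * n - R l ≤ t then 0 else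
      startAge n a₀ (fun j => deliveryIndicator (R j)) l := by
  have hafter : ∀ j : ℕ, (j + 1) * n - R j ≤ t → j ≤ l := fun j hj => by
    have hlt : (j : ℝ) * n < (l + 1) * n := by linarith [ht.2, hRn j]
    exact Nat.le_of_lt_succ (by exact_mod_cast lt_of_mul_lt_mul_right hlt hn.le)
  by_cases h : (l + 1) * n - R l ≤ t
  · have hRl : 0 < R l := by linarith [ht.2]
    have hgreatest : IsGreatest
        (insert (-a₀) {s | ∃ j : ℕ, (0 < R j ∧ (j + 1) * n - R j ≤ t) ∧ s = j * n}) (l * n) := by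
      refine ⟨Or.inr ⟨l, ⟨hRl, h⟩, rfl⟩, ?_⟩
      rintro s (rfl | ⟨j, ⟨-, hj⟩, rfl⟩)
      · exact (neg_nonpos.2 ha₀).trans (by positivity)
      · gcongr
        exact hafter j hj
    rw [slottedAge, hgreatest.csSup_eq, if_pos h, add_zero]
  · have hset : {s | ∃ j : ℕ, (0 < R j ∧ (j + 1) * n - R j ≤ t) ∧ s = j * n} =
        {s | ∃ j < l, 0 < R j ∧ s = j * n} := by
      ext s
      refine exists_congr fun j => ⟨fun ⟨⟨hR, hj⟩, hs⟩ => ⟨?_, hR, hs⟩,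
        fun ⟨hj, hR, hs⟩ => ⟨⟨hR, ?_⟩, hs⟩⟩
      · exact lt_of_le_of_ne (hafter j hj) fun hjl => h (hjl ▸ hj)
      · have hjl : ((j : ℝ) + 1) * n ≤ l * n := by
          gcongr
          exact_mod_cast hj
        linarith [ht.1]
    rw [slottedAge, hset, (isGreatest_sub_startAge hn.le ha₀ l).csSup_eq, if_neg h]
    ring

lemma hasAverageAge_slottedAge (hn : 0 < n) (ha₀ : 0 ≤ a₀) (hR₀ : ∀ j, 0 ≤ R j)
    (hRn : ∀ j, R j ≤ n) {α β : ℝ}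
    (hα : Tendsto (fun L : ℕ => (∑ l ∈ Finset.range L,
      startAge n a₀ (fun j => deliveryIndicator (R j)) l) / L) atTop (𝓝 α))
    (hβ : Tendsto (fun L : ℕ => (∑ l ∈ Finset.range L,
      R l * startAge n a₀ (fun j => deliveryIndicator (R j)) l) / L) atTop (𝓝 β)) :
    HasAverageAge (slottedAge n a₀ R) ((n * α + n ^ 2 / 2 - β) / n) := by
  set A := startAge n a₀ fun j => deliveryIndicator (R j)
  have hslot : ∀ l : ℕ, IntervalIntegrable (slottedAge n a₀ R) volume (l * n) ((l + 1 : ℕ) * n) ∧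
      ∫ t in (l * n : ℝ)..((l + 1 : ℕ) * n), slottedAge n a₀ R t =
        n * A l + n ^ 2 / 2 - R l * A l := fun l => by
    push_cast
    have h := integral_sawtooth (by linarith [hRn l]) (hR₀ l) fun t ht =>
      slottedAge_eq hn ha₀ hRn ht
    rwa [show ((l : ℝ) + 1) * n - l * n = n by ring] at h
  refine hasAverageAge_of_tendsto_average_slots hn (fun t => slottedAge_nonneg ha₀ hRn)
    (fun l => (hslot l).1) (fun l => (hslot l).2)
    ((((hα.const_mul n).add_const (n ^ 2 / 2)).sub hβ).congr' ?_)
  filter_upwards [eventually_ne_atTop 0] with L hL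
  rw [Finset.sum_sub_distrib, Finset.sum_add_distrib, ← Finset.mul_sum, Finset.sum_const,
    Finset.card_range, nsmul_eq_mul]
  field_simp

section Random

variable {Ω : Type*} {mΩ : MeasurableSpace Ω} {P : Measure Ω} {R : ℕ → Ω → ℝ} {p r : ℝ}

lemma integral_deliveryIndicator {X : Ω → ℝ} (hX : Measurable X) :
    ∫ ω, deliveryIndicator (X ω) ∂P = P.real {ω | 0 < X ω} :=
  integral_indicator_one (hX measurableSet_Ioi)

theorem ae_hasAverageAge_slottedAge_of_measurable (hR : ∀ l, Measurable (R l))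
    (hind : iIndepFun R P) (hn : 0 < n) (ha₀ : 0 ≤ a₀) (hR₀ : ∀ l ω, 0 ≤ R l ω)
    (hRn : ∀ l ω, R l ω ≤ n) (hp : 0 < p) (hRp : ∀ l, P.real {ω | 0 < R l ω} = p)
    (hRr : ∀ l, ∫ ω, R l ω ∂P = r) :
    ∀ᵐ ω ∂P, HasAverageAge (slottedAge n a₀ (R · ω)) (n / p + n / 2 - r / p) := by
  have := hind.isProbabilityMeasure
  have hinn := isInnovation_pastFiltration hR hind
  have hI := hinn.comp measurable_deliveryIndicator
  have hmean : ∀ l, ∫ ω, deliveryIndicator (R l ω) ∂P = p := fun l =>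
    (integral_deliveryIndicator (hR l)).trans (hRp l)
  filter_upwards [
    ae_tendsto_average_startAge hI (fun _ _ => deliveryIndicator_nonneg _)
      (fun _ _ => deliveryIndicator_le_one _) hp hmean hn.le ha₀,
    ae_tendsto_average_mul_startAge hI (fun _ _ => deliveryIndicator_nonneg _)
      (fun _ _ => deliveryIndicator_le_one _) hp hmean hn.le ha₀ hinn
      (fun l ω => (abs_of_nonneg (hR₀ l ω)).trans_le (hRn l ω)) hRr] with ω hα hβ
  convert hasAverageAge_slottedAge hn ha₀ (hR₀ · ω) (hRn · ω) hα hβ using 1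
  field_simp

theorem ae_hasAverageAge_slottedAge (hR : ∀ l, AEMeasurable (R l) P)
    (hind : iIndepFun R P) (hn : 0 < n) (ha₀ : 0 ≤ a₀) (hR₀ : ∀ l ω, 0 ≤ R l ω)
    (hRn : ∀ l ω, R l ω ≤ n) (hp : 0 < p) (hRp : ∀ l, P.real {ω | 0 < R l ω} = p)
    (hRr : ∀ l, ∫ ω, R l ω ∂P = r) :
    ∀ᵐ ω ∂P, HasAverageAge (slottedAge n a₀ (R · ω)) (n / p + n / 2 - r / p) := by
  set R' : ℕ → Ω → ℝ := fun l ω => max 0 (min n ((hR l).mk (R l) ω))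
  have hRR' : ∀ l, R l =ᵐ[P] R' l := fun l => by
    filter_upwards [(hR l).ae_eq_mk] with ω hω
    simp only [R', ← hω, min_eq_right (hRn l ω), max_eq_right (hR₀ l ω)]
  have hRp' : ∀ l, P.real {ω | 0 < R' l ω} = p := fun l => by
    rw [← hRp l]
    refine measureReal_congr ?_
    filter_upwards [hRR' l] with ω hω
    change (0 < R' l ω) = (0 < R l ω)
    rw [hω]
  have hmain := ae_hasAverageAge_slottedAge_of_measurable
    (fun l => measurable_const.max (measurable_const.min (hR l).measurable_mk))
    (hind.congr hRR') hn ha₀ (fun l ω => le_max_left _ _)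
    (fun l ω => max_le hn.le (min_le_left _ _)) hp hRp'
    fun l => (integral_congr_ae (hRR' l)).symm.trans (hRr l)
  filter_upwards [hmain, ae_all_iff.2 hRR'] with ω hω heq
  rwa [funext heq]

end Random

end SlottedAge

section Decoder

variable {F : Type*} [Field F] {k n : ℕ} {ι κ : Type*}

lemma Decodable.mono {col : ι → Fin k → F} {S T : Set ι} (h : Decodable col S) (hST : S ⊆ T) :
    Decodable col T :=
  let ⟨s, hs, hli⟩ := h
  ⟨s, fun j => hST (hs j), hli⟩

lemma Decodable.nonempty {col : ι → Fin k → F} {S : Set ι} (h : Decodable col S) (hk : 1 ≤ k) :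
    S.Nonempty :=
  let ⟨s, hs, _⟩ := h
  ⟨s ⟨0, hk⟩, hs _⟩

lemma decodable_comp_iff_image {col : ι → Fin k → F} {f : κ → ι} {S : Set κ} :
    Decodable (fun i => col (f i)) S ↔ Decodable col (f '' S) := by
  constructor
  · rintro ⟨s, hs, hli⟩
    exact ⟨fun j => f (s j), fun j => Set.mem_image_of_mem f (hs j), hli⟩
  · rintro ⟨s, hs, hli⟩
    choose t ht hst using hs
    exact ⟨t, ht, by simpa only [hst] using hli⟩

lemma Decodable.eq_of_encode_eq {G : Matrix (Fin k) (Fin n) F} {S : Set (Fin n)}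
    (h : Decodable (fun i j => G j i) S) {u v : Fin k → F}
    (huv : ∀ i ∈ S, encode G u i = encode G v i) : u = v := by
  obtain ⟨s, hs, hli⟩ := h
  have hunit : IsUnit (Matrix.of fun i j : Fin k => G j (s i)) :=
    Matrix.linearIndependent_rows_iff_isUnit.1 hli
  refine Matrix.mulVec_injective_of_isUnit hunit (funext fun i => ?_)
  have h := huv (s i) (hs i)
  simp only [encode, Matrix.vecMul, Matrix.mulVec, dotProduct, Matrix.of_apply] at h ⊢
  simpa only [mul_comm] using h

lemma receivedSet_channel {F : Type*} (e : Fin n → Bool) (z : Fin n → F) (m : ℕ) :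
    receivedSet (channel e z) m = {i : Fin n | (i : ℕ) < m ∧ e i = false} := by
  ext i
  cases h : e i <;> simp [receivedSet, channel, h]

lemma decode_channel_eq_some_iff (G : Matrix (Fin k) (Fin n) F) (e : Fin n → Bool)
    (u : Fin k → F) (m : ℕ) :
    decode G (channel e (encode G u)) m = some u ↔
      Decodable (fun i j => G j i) {i : Fin n | (i : ℕ) < m ∧ e i = false} := by
  have hreceived : ∀ i ∈ receivedSet (channel e (encode G u)) m,
      channel e (encode G u) i = some (encode G u i) := fun i hi => by
    rw [receivedSet_channel] at hi
    simp [channel, hi.2]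
  rw [decode, ← receivedSet_channel e (encode G u)]
  split_ifs with h
  · refine iff_of_true ?_ h.1
    rw [Option.some_inj]
    refine h.1.eq_of_encode_eq fun i hi => ?_
    rw [← Option.some_inj, ← h.2.choose_spec i hi, hreceived i hi]
  · exact iff_of_false nofun fun hdec => h ⟨hdec, u, hreceived⟩

lemma B_le_iff {x : ℕ → (Fin k → F) × Bool} {m : ℕ} :
    B x ≤ m ↔ Decodable (fun i => (x i).1) {i : ℕ | i < m ∧ (x i).2 = false} := by
  refine ⟨fun h => ?_, fun h => iInf₂_le m h⟩
  have hlt : B x < (m + 1 : ℕ) := h.trans_lt (by exact_mod_cast m.lt_succ_self)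
  obtain ⟨m', hdec, hm'⟩ := by simpa only [B, iInf_lt_iff] using hlt
  have hle : m' ≤ m := Nat.le_of_lt_succ (by exact_mod_cast hm')
  exact hdec.mono fun i hi => ⟨hi.1.trans_le hle, hi.2⟩

lemma one_le_B (hk : 1 ≤ k) (x : ℕ → (Fin k → F) × Bool) : 1 ≤ B x := by
  refine le_iInf₂ fun m hm => ?_
  obtain ⟨i, hi, -⟩ := hm.nonempty hk
  exact_mod_cast Nat.one_le_of_lt hi

/-- The channel uses `y` of a packet allow decoding after the first `m` of them. -/
def DecodableBy (y : Fin n → (Fin k → F) × Bool) (m : ℕ) : Prop :=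
  Decodable (fun i => (y i).1) {i : Fin n | (i : ℕ) < m ∧ (y i).2 = false}

lemma DecodableBy.mono {y : Fin n → (Fin k → F) × Bool} : Monotone (DecodableBy y) :=
  fun _ _ hm h => Decodable.mono h fun _ hi => ⟨hi.1.trans_le hm, hi.2⟩

lemma decodableBy_restrict_iff {x : ℕ → (Fin k → F) × Bool} {m : ℕ} (hm : m ≤ n) :
    DecodableBy (fun i : Fin n => x i) m ↔ B x ≤ m := by
  rw [DecodableBy, B_le_iff, decodable_comp_iff_image (col := fun i => (x i).1)]
  congr!
  ext i
  exact ⟨fun ⟨_, hj, hji⟩ => hji ▸ hj, fun hi => ⟨⟨i, hi.1.trans_le hm⟩, hi, rfl⟩⟩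

open Classical in
/-- The time between the delivery of a packet and the end of its slot, as a count of the channel
uses after which the packet is decoded; it is `0` for a lost packet. -/
noncomputable def residualTime (y : Fin n → (Fin k → F) × Bool) : ℕ :=
  ({m ∈ Finset.Icc 1 n | DecodableBy y m} : Finset ℕ).card

lemma residualTime_le (y : Fin n → (Fin k → F) × Bool) : residualTime y ≤ n := by
  classical exact (Finset.card_filter_le _ _).trans (by simp)

lemma decodableBy_iff_le_residualTime_add {y : Fin n → (Fin k → F) × Bool} {m : ℕ}
    (hm₀ : 1 ≤ m) (hm : m ≤ n) : DecodableBy y m ↔ n + 1 ≤ residualTime y + m := by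
  classical
  constructor <;> intro h
  · have hcard : (Finset.Icc m n).card ≤ residualTime y := Finset.card_le_card fun i hi => by
      rw [Finset.mem_Icc] at hi
      exact Finset.mem_filter.2
        ⟨Finset.mem_Icc.2 ⟨hm₀.trans hi.1, hi.2⟩, DecodableBy.mono hi.1 h⟩
    rw [Nat.card_Icc] at hcard
    lia
  · by_contra hdec
    have hcard : residualTime y ≤ (Finset.Ioc m n).card := Finset.card_le_card fun i hi => by
      obtain ⟨hin, hi⟩ := Finset.mem_filter.1 hi
      exact Finset.mem_Ioc.2
        ⟨lt_of_not_ge fun him => hdec (DecodableBy.mono him hi), (Finset.mem_Icc.1 hin).2⟩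
    rw [Nat.card_Ioc] at hcard
    lia

lemma residualTime_pos_iff (hn : 1 ≤ n) {y : Fin n → (Fin k → F) × Bool} :
    0 < residualTime y ↔ DecodableBy y n := by
  rw [decodableBy_iff_le_residualTime_add hn le_rfl]
  lia

lemma residualTime_restrict (hk : 1 ≤ k) {x : ℕ → (Fin k → F) × Bool} (hx : B x ≤ n) :
    (residualTime (fun i : Fin n => x i) : ℝ) = n + 1 - (B x).toNat := by
  classical
  obtain ⟨b, hb⟩ := ENat.ne_top_iff_exists.1 (ne_top_of_le_ne_top (ENat.natCast_ne_top n) hx)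
  have hb₁ : 1 ≤ b := by exact_mod_cast hb ▸ one_le_B hk x
  have hbn : b ≤ n := by exact_mod_cast hb ▸ hx
  have hfilter : ∀ m ∈ Finset.Icc 1 n, DecodableBy (fun i : Fin n => x i) m ↔ b ≤ m :=
    fun m hm => by
      rw [decodableBy_restrict_iff (Finset.mem_Icc.1 hm).2, ← hb, ENat.natCast_le_natCast]
  have hcard : residualTime (fun i : Fin n => x i) = n + 1 - b := by
    rw [residualTime, Finset.filter_congr hfilter, ← Nat.card_Icc]
    congr 1
    ext m
    simp only [Finset.mem_filter, Finset.mem_Icc]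
    lia
  rw [hcard, ← hb, ENat.toNat_natCast, Nat.cast_sub (by lia)]
  push_cast
  ring

lemma deliveredBy_iff (G : ℕ → Matrix (Fin k) (Fin n) F) (e : ℕ → Fin n → Bool)
    (u : ℕ → Fin k → F) (l : ℕ) (t : ℝ) :
    DeliveredBy G e u l t ↔
      0 < residualTime (fun i => ((fun j => G l j i), e l i)) ∧
        (l + 1) * n - residualTime (fun i => ((fun j => G l j i), e l i)) ≤ t := by
  set y : Fin n → (Fin k → F) × Bool := fun i => ((fun j => G l j i), e l i)
  have hdec : ∀ i : Fin n, decode (G l) (channel (e l) (encode (G l) (u (l * n)))) (i + 1) =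
      some (u (l * n)) ↔ n ≤ residualTime y + i := fun i => by
    have h : _ ↔ DecodableBy y (i + 1) :=
      decode_channel_eq_some_iff (G l) (e l) (u (l * n)) (i + 1)
    rw [h, decodableBy_iff_le_residualTime_add (by lia) (by lia)]
    lia
  have hle := residualTime_le y
  simp only [DeliveredBy, hdec]
  push_cast
  constructor
  · rintro ⟨i, hi, ht⟩
    have hi' : (n : ℝ) ≤ residualTime y + (i : ℕ) := by exact_mod_cast hi
    exact ⟨by lia, by linarith⟩
  · rintro ⟨hpos, ht⟩
    refine ⟨⟨n - residualTime y, by lia⟩, by simp only; lia, ?_⟩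
    rw [Nat.cast_sub hle]
    linarith

lemma age_eq_slottedAge (G : ℕ → Matrix (Fin k) (Fin n) F) (e : ℕ → Fin n → Bool)
    (u : ℕ → Fin k → F) (a₀ : ℝ) :
    age G e u a₀ =
      slottedAge n a₀ fun l => residualTime fun i => ((fun j => G l j i), e l i) := by
  ext t
  simp only [age, freshest, slottedAge, deliveredBy_iff, Nat.cast_pos, Nat.cast_mul]

end Decoder

section Law

variable {F : Type*} [Field F] [Finite F] [MeasurableSpace F] [DiscreteMeasurableSpace F]
  {k n : ℕ} {ε : unitInterval}

lemma isProbabilityMeasure_useLaw (hk : 1 ≤ k) (ε : unitInterval) :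
    IsProbabilityMeasure (useLaw F k ε) := by
  have : IsProbabilityMeasure (uniformOn {v : Fin k → F | v ≠ 0}) :=
    isProbabilityMeasure_uniformOn (Set.toFinite _)
      ⟨fun _ => 1, fun h => one_ne_zero (congrFun h ⟨0, hk⟩)⟩
  unfold useLaw
  infer_instance

lemma isProbabilityMeasure_packetLaw (hk : 1 ≤ k) (ε : unitInterval) :
    IsProbabilityMeasure (packetLaw F k ε) := by
  have := isProbabilityMeasure_useLaw (F := F) hk ε
  unfold packetLaw
  infer_instance

lemma useLaw_singleton_ne_zero (hε : (ε : ℝ) < 1) {v : Fin k → F} (hv : v ≠ 0) :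
    useLaw F k ε {(v, false)} ≠ 0 := by
  have hcol : uniformOn {v : Fin k → F | v ≠ 0} {v} ≠ 0 := by
    rw [Ne, uniformOn_eq_zero_iff (Set.toFinite _)]
    exact Set.Nonempty.ne_empty ⟨v, hv, rfl⟩
  have hreceived : bernoulliMeasure true false ε {false} ≠ 0 := by
    rw [bernoulliMeasure_apply_of_notMem_of_mem _ (by simp) (by simp) (Set.mem_singleton _),
      ENNReal.coe_ne_zero, ← NNReal.coe_ne_zero, unitInterval.coe_toNNReal,
      unitInterval.coe_symm_eq]
    exact (sub_pos.2 hε).ne'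
  rw [useLaw, ← Set.singleton_prod_singleton, Measure.prod_prod]
  exact mul_ne_zero hcol hreceived

lemma hasLaw_restrict_packetLaw (hk : 1 ≤ k) (n : ℕ) (ε : unitInterval) :
    HasLaw (fun (x : ℕ → (Fin k → F) × Bool) (i : Fin n) => x i)
      (Measure.infinitePi fun _ => useLaw F k ε) (packetLaw F k ε) := by
  have := isProbabilityMeasure_useLaw (F := F) hk ε
  exact ⟨Measurable.aemeasurable (by fun_prop),
    Measure.map_infinitePi_infinitePi_of_inj (P := fun _ : ℕ => useLaw F k ε) Fin.val_injective⟩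

lemma measurableSet_B_le (n : ℕ) : MeasurableSet {x : ℕ → (Fin k → F) × Bool | B x ≤ n} := by
  have hrestrict : {x : ℕ → (Fin k → F) × Bool | B x ≤ n} =
      (fun x (i : Fin n) => x i) ⁻¹' {y | DecodableBy y n} :=
    Set.ext fun x => (decodableBy_restrict_iff le_rfl).symm
  rw [hrestrict]
  exact (by fun_prop : Measurable fun (x : ℕ → (Fin k → F) × Bool) (i : Fin n) => x i)
    (Set.toFinite _).measurableSet

lemma measureReal_B_le (hk : 1 ≤ k) (n : ℕ) (ε : unitInterval) :
    (packetLaw F k ε).real {x | B x ≤ n} = 1 - erasureProb F k n ε := by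
  have := isProbabilityMeasure_packetLaw (F := F) hk ε
  have hcompl : {x : ℕ → (Fin k → F) × Bool | n < B x} = {x | B x ≤ n}ᶜ := by
    ext x
    simp
  rw [erasureProb, hcompl, probReal_compl_eq_one_sub (measurableSet_B_le n), sub_sub_cancel]

lemma measureReal_decodableBy (hk : 1 ≤ k) (n : ℕ) (ε : unitInterval) :
    (Measure.infinitePi fun _ => useLaw F k ε).real
      {y : Fin n → (Fin k → F) × Bool | DecodableBy y n} = 1 - erasureProb F k n ε := by
  rw [← measureReal_B_le hk,
    ← (hasLaw_restrict_packetLaw hk n ε).measureReal_eq (Set.toFinite _).measurableSet]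
  simp only [decodableBy_restrict_iff le_rfl]

lemma erasureProb_lt_one (hk : 1 ≤ k) (hkn : k ≤ n) (hε : (ε : ℝ) < 1) :
    erasureProb F k n ε < 1 := by
  have := isProbabilityMeasure_useLaw (F := F) hk ε
  let y : Fin n → (Fin k → F) × Bool := fun i =>
    (Pi.single (if h : (i : ℕ) < k then ⟨i, h⟩ else ⟨0, hk⟩) 1, false)
  have hy : DecodableBy y n := by
    refine ⟨Fin.castLE hkn, fun j => ⟨(Fin.castLE hkn j).2, rfl⟩, ?_⟩
    have hsingle : (fun j : Fin k => (y (Fin.castLE hkn j)).1) = fun j => Pi.single j 1 := by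
      ext j : 1
      simp [y]
    rw [hsingle]
    exact Pi.linearIndependent_single_one (Fin k) F
  have hpos : (Measure.infinitePi fun _ : Fin n => useLaw F k ε) {y} ≠ 0 := by
    rw [Measure.infinitePi_singleton_of_fintype]
    exact Finset.prod_ne_zero_iff.2 fun i _ => useLaw_singleton_ne_zero hε (by simp)
  rw [← sub_pos, ← measureReal_decodableBy hk]
  exact ENNReal.toReal_pos
    (ne_bot_of_le_ne_bot hpos (measure_mono (Set.singleton_subset_iff.2 hy))) (measure_ne_top _ _)

lemma integral_residualTime (hk : 1 ≤ k) (hn : 1 ≤ n) (hε : erasureProb F k n ε < 1) :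
    ∫ y, (residualTime y : ℝ) ∂(Measure.infinitePi fun _ : Fin n => useLaw F k ε) =
      (1 - erasureProb F k n ε) * (n + 1 - meanT F k n ε) := by
  have := isProbabilityMeasure_packetLaw (F := F) hk ε
  have hs := measurableSet_B_le (F := F) (k := k) n
  have hp := sub_pos.2 hε
  rw [← measureReal_B_le hk] at hp ⊢
  set μ := packetLaw F k ε
  set s := {x : ℕ → (Fin k → F) × Bool | B x ≤ n}
  set ρ : (ℕ → (Fin k → F) × Bool) → ℝ := fun x => residualTime fun i : Fin n => x i
  have hρ_meas : AEMeasurable ρ μ :=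
    (Measurable.of_discrete (f := fun y => (residualTime y : ℝ))).comp_aemeasurable
      (hasLaw_restrict_packetLaw hk n ε).aemeasurable
  have hρ : Integrable ρ μ := .of_bound hρ_meas.aestronglyMeasurable n
    (ae_of_all _ fun x => by simp [ρ, residualTime_le])
  have hρs : ∫ x in s, ρ x ∂μ = ∫ x, ρ x ∂μ :=
    setIntegral_eq_integral_of_forall_compl_eq_zero fun x hx => by
      rw [Nat.cast_eq_zero, ← Nat.le_zero, ← not_lt, residualTime_pos_iff hn,
        decodableBy_restrict_iff le_rfl]
      exact hx
  have hB : ∫ x in s, ((B x).toNat : ℝ) ∂μ = μ.real s * (n + 1) - ∫ x, ρ x ∂μ := by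
    rw [← hρs, ← smul_eq_mul, ← setIntegral_const,
      ← integral_sub (integrable_const _) hρ.integrableOn]
    refine setIntegral_congr_fun hs fun x hx => ?_
    simp only [ρ, residualTime_restrict hk hx, sub_sub_cancel]
  have hmean : meanT F k n ε = (μ.real s)⁻¹ * ∫ x in s, ((B x).toNat : ℝ) ∂μ := by
    rw [meanT, ProbabilityTheory.cond, integral_smul_measure, smul_eq_mul, ENNReal.toReal_inv]
    rfl
  rw [← (hasLaw_restrict_packetLaw hk n ε).integral_comp .of_discrete, hmean, hB]
  simp only [Function.comp_def]
  field_simp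
  ring

end Law

section Blocks

variable {Ω : Type*} {mΩ : MeasurableSpace Ω} {P : Measure Ω}

lemma iIndepFun_curry {ι κ 𝓧 : Type*} [Countable ι] [Countable κ] [MeasurableSpace 𝓧]
    {V : ι × κ → Ω → 𝓧} (hind : iIndepFun V P) (hV : ∀ i, AEMeasurable (V i) P) :
    iIndepFun (fun i ω j => V (i, j) ω) P := by
  have := hind.isProbabilityMeasure
  have (i : ι × κ) : IsProbabilityMeasure (P.map (V i)) := Measure.isProbabilityMeasure_map (hV i)
  have hblock (i : ι) :
      P.map (fun ω j => V (i, j) ω) = Measure.infinitePi fun j => P.map (V (i, j)) :=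
    (hind.precomp (Prod.mk_right_injective i)).map_fun_eq_infinitePi_map₀' fun j => hV (i, j)
  rw [iIndepFun_iff_map_fun_eq_infinitePi_map₀' fun i => aemeasurable_pi_iff.2 fun j => hV (i, j)]
  simp_rw [hblock]
  rw [← Measure.infinitePi_map_curry fun i j => P.map (V (i, j)),
    ← hind.map_fun_eq_infinitePi_map₀' hV, AEMeasurable.map_map_of_aemeasurable (by fun_prop)
      (aemeasurable_pi_iff.2 hV)]
  rfl

variable {F : Type*} [Field F] [Finite F] [MeasurableSpace F] [DiscreteMeasurableSpace F]
  {k n : ℕ} {ε : unitInterval}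

theorem ae_hasAverageAge_residualTime {V : ℕ × Fin n → Ω → (Fin k → F) × Bool}
    (hind : iIndepFun V P) (hV : ∀ i, HasLaw (V i) (useLaw F k ε) P) (hk : 1 ≤ k) (hn : 1 ≤ n)
    (hε : erasureProb F k n ε < 1) {a₀ : ℝ} (ha₀ : 0 ≤ a₀) :
    ∀ᵐ ω ∂P, HasAverageAge (slottedAge n a₀ fun l => residualTime fun i => V (l, i) ω)
      (meanT F k n ε - 1 + n * (1 + erasureProb F k n ε) / (2 * (1 - erasureProb F k n ε))) := by
  have hblock : ∀ l, HasLaw (fun ω i => V (l, i) ω) (Measure.infinitePi fun _ => useLaw F k ε) P :=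
    fun l => (hind.precomp (Prod.mk_right_injective l)).hasLaw_infinitePi (fun i => hV (l, i))
      (aemeasurable_pi_iff.2 fun i => (hV (l, i)).aemeasurable)
  set ρ : (Fin n → (Fin k → F) × Bool) → ℝ := fun y => residualTime y
  have hρ : Measurable ρ := .of_discrete
  have hdelivered : ∀ l, P.real {ω | 0 < ρ fun i => V (l, i) ω} = 1 - erasureProb F k n ε :=
    fun l => by
      simp only [ρ, Nat.cast_pos, residualTime_pos_iff hn]
      exact ((hblock l).measureReal_eq (p := (DecodableBy · n))
        (Set.toFinite _).measurableSet).trans (measureReal_decodableBy hk n ε)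
  have hmean : ∀ l, ∫ ω, ρ (fun i => V (l, i) ω) ∂P =
      (1 - erasureProb F k n ε) * (n + 1 - meanT F k n ε) := fun l =>
    ((hblock l).integral_comp .of_discrete).trans (integral_residualTime hk hn hε)
  have hp := sub_pos.2 hε
  have hval : meanT F k n ε - 1 + n * (1 + erasureProb F k n ε) / (2 * (1 - erasureProb F k n ε)) =
      n / (1 - erasureProb F k n ε) + n / 2 -
        (1 - erasureProb F k n ε) * (n + 1 - meanT F k n ε) / (1 - erasureProb F k n ε) := by
    field_simp
    ring
  rw [hval]
  exact ae_hasAverageAge_slottedAge (fun l => hρ.comp_aemeasurable (hblock l).aemeasurable)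
    ((iIndepFun_curry hind fun i => (hV i).aemeasurable).comp₀ (fun _ => ρ)
      (fun l => (hblock l).aemeasurable) (fun _ => hρ.aemeasurable))
    (Nat.cast_pos.2 hn) ha₀ (fun _ _ => Nat.cast_nonneg _)
    (fun _ _ => Nat.cast_le.2 (residualTime_le _)) hp hdelivered hmean

end Blocks

end RandomLinearScheme

theorem theorem5 {F : Type*} [Field F] [Finite F] [MeasurableSpace F] [DiscreteMeasurableSpace F]
    {Ω : Type*} [MeasurableSpace Ω] (P : Measure Ω) [IsProbabilityMeasure P]
    (k n : ℕ) (hk : 1 ≤ k) (hkn : k ≤ n) (ε : unitInterval) (hε : (ε : ℝ) < 1)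
    (u : ℕ → Ω → Fin k → F)
    (G : ℕ → Ω → Matrix (Fin k) (Fin n) F)
    (e : ℕ → Ω → Fin n → Bool)
    (hindep : iIndepFun
      (fun (p : ℕ × Fin n) (ω : Ω) => ((fun j : Fin k => G p.1 ω j p.2), e p.1 ω p.2)) P)
    (hlaw : ∀ p : ℕ × Fin n,
      HasLaw (fun ω : Ω => ((fun j : Fin k => G p.1 ω j p.2), e p.1 ω p.2))
        (RandomLinearScheme.useLaw F k ε) P)
    (a₀ : ℝ) (ha₀ : 0 ≤ a₀) :
    ∀ᵐ ω ∂P, RandomLinearScheme.HasAverageAge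
      (RandomLinearScheme.age (fun l => G l ω) (fun l => e l ω) (fun m => u m ω) a₀)
      (RandomLinearScheme.meanT F k n ε - 1 +
        n * (1 + RandomLinearScheme.erasureProb F k n ε) /
          (2 * (1 - RandomLinearScheme.erasureProb F k n ε))) := by
  simp only [RandomLinearScheme.age_eq_slottedAge]
  exact RandomLinearScheme.ae_hasAverageAge_residualTime hindep hlaw hk (hk.trans hkn)
    (RandomLinearScheme.erasureProb_lt_one hk hkn hε) ha₀
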